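/- **Setting.** A state is a vector $\mathbf U=(\rho,\mathbf m,\mathbf B,E)\in\mathbb R\times\mathbb R^3\times\mathbb R^3\times\mathbb R$, with velocity $\mathbf v=\mathbf m/\rho$, internal energy $\mathcal E(\mathbf U)=E-\tfrac12\big(|\mathbf m|^2/\rho+|\mathbf B|^2\big)$ and $e=\mathcal E(\mathbf U)/\rho$. The set of admissible states is $\mathcal G=\{\mathbf U:\rho>0,\ \mathcal E(\mathbf U)>0\}$. Let $p=p(\rho,e)$ be an equation of state such that, whenever $\rho>0$, one has $e>0\Leftrightarrow p(\rho,e)>0$. With $p_{tot}=p+\tfrac12|\mathbf B|^2$ and $\mathbf e_\ell$ the $\ell$-th unit vector, the ideal MHD fluxes are $$\mathbf F_\ell(\mathbf U)=\big(\rho v_\ell,\ \rho v_\ell\mathbf v-B_\ell\mathbf B+p_{tot}\mathbf e_\ell,\ v_\ell\mathbf B-B_\ell\mathbf v,\ v_\ell(E+p_{tot})-B_\ell(\mathbf v\cdot\mathbf B)\big).$$ For two states $\mathbf U,\tilde{\mathbf U}$ put $\alpha_\ell(\mathbf U,\tilde{\mathbf U})=\min_{\sigma\in\mathbb R}\alpha_\ell(\mathbf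 U,\tilde{\mathbf U};\sigma)$, where $$\alpha_\ell(\mathbf U,\tilde{\mathbf U};\sigma)=\max\big\{|v_\ell|+\mathscr C_\ell,\ |\tilde v_\ell|+\tilde{\mathscr C}_\ell,\ |\sigma v_\ell+(1-\sigma)\tilde v_\ell|+\max\{\mathscr C_\ell,\tilde{\mathscr C}_\ell\}\big\}+\frac{|\tilde{\mathbf B}-\mathbf B|}{\sqrt2}\sqrt{\frac{\sigma^2}{\rho}+\frac{(1-\sigma)^2}{\tilde\rho}},$$ $$\mathscr C_\ell=\frac1{\sqrt2}\Big[\mathscr C_s^2+\tfrac{|\mathbf B|^2}{\rho}+\sqrt{\big(\mathscr C_s^2+\tfrac{|\mathbf B|^2}{\rho}\big)^2-4\tfrac{\mathscr C_s^2B_\ell^2}{\rho}}\Big]^{1/2},\qquad \mathscr C_s=\frac{p}{\rho\sqrt{2e}},$$ and $\tilde{\mathscr C}_\ell$ is the same expression for $\tilde{\mathbf U}$. **Scheme.** Consider a uniform rectangular mesh with cells $I_{ij}=(x_{i-1/2},x_{i+1/2})\times(y_{j-1/2},y_{j+1/2})$, $i,j\in\mathbb Z$, of side lengths $\Delta x,\Delta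 y>0$. Let $K,Q,L$ be natural numbers with $2Q\ge K+1$ and $2L\ge K+3$. On each cell let $\mathbf U_{ij}(x,y)$ be a vector of polynomials of total degree at most $K$ (the data at time level $n$), with cell average $\bar{\mathbf U}^n_{ij}$ over $I_{ij}$. Let $x_i^{(\mu)},y_j^{(\mu)}$ ($1\le\mu\le Q$) be the nodes of the $Q$-point Gauss quadrature in $[x_{i-1/2},x_{i+1/2}]$ and $[y_{j-1/2},y_{j+1/2}]$, with weights $\omega_\mu$, $\sum_\mu\omega_\mu=1$. Let $\hat x_i^{(\nu)},\hat y_j^{(\nu)}$ ($1\le\nu\le L$) be the nodes, in increasing order, of the $L$-point Gauss–Lobatto quadrature in the same intervals, with weights $\hat\omega_\nu$, $\sum_\nu\hat\omega_\nu=1$. Put $$\mathbf U^{-,\mu}_{i+\frac12,j}=\mathbf U_{ij}(x_{i+\frac12},y_j^{(\mu)}),\quad \mathbf U^{+,\mu}_{i+\frac12,j}=\mathbf U_{i+1,j}(x_{i+\frac12},y_j^{(\mu)}),$$ $$\mathbf U^{\mu,-}_{i,j+\frac12}=\mathbf U_{ij}(x_i^{(\mu)},y_{j+\frac12}),\quad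 \mathbf U^{\mu,+}_{i,j+\frac12}=\mathbf U_{i,j+1}(x_i^{(\mu)},y_{j+\frac12}).$$ With real viscosity parameters $\alpha_1^{LF},\alpha_2^{LF}$, the Lax–Friedrichs fluxes $\hat{\mathbf F}_\ell(\mathbf U^-,\mathbf U^+)=\frac12\big(\mathbf F_\ell(\mathbf U^-)+\mathbf F_\ell(\mathbf U^+)-\alpha_\ell^{LF}(\mathbf U^+-\mathbf U^-)\big)$ and a time step $\Delta t$, let $$\bar{\mathbf U}^{n+1}_{ij}=\bar{\mathbf U}^n_{ij}-\frac{\Delta t}{\Delta x}\sum_{\mu=1}^Q\omega_\mu\Big(\hat{\mathbf F}_1(\mathbf U^{-,\mu}_{i+\frac12,j},\mathbf U^{+,\mu}_{i+\frac12,j})-\hat{\mathbf F}_1(\mathbf U^{-,\mu}_{i-\frac12,j},\mathbf U^{+,\mu}_{i-\frac12,j})\Big)-\frac{\Delta t}{\Delta y}\sum_{\mu=1}^Q\omega_\mu\Big(\hat{\mathbf F}_2(\mathbf U^{\mu,-}_{i,j+\frac12},\mathbf U^{\mu,+}_{i,j+\frac12})-\hat{\mathbf F}_2(\mathbf U^{\mu,-}_{i,j-\frac12},\mathbf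 U^{\mu,+}_{i,j-\frac12})\Big).$$ The discrete divergence is $$\mathrm{div}_{ij}\mathbf B^n=\frac1{\Delta x}\sum_{\mu=1}^Q\omega_\mu\Big(\overline{(B_1)}^{\mu}_{i+\frac12,j}-\overline{(B_1)}^{\mu}_{i-\frac12,j}\Big)+\frac1{\Delta y}\sum_{\mu=1}^Q\omega_\mu\Big(\overline{(B_2)}^{\mu}_{i,j+\frac12}-\overline{(B_2)}^{\mu}_{i,j-\frac12}\Big),$$ where an overline denotes the arithmetic mean of the two limiting values (signs $-$ and $+$). **Theorem.** Assume that 1. (admissibility) $\mathbf U_{ij}(\hat x_i^{(\nu)},y_j^{(\mu)})\in\mathcal G$ and $\mathbf U_{ij}(x_i^{(\mu)},\hat y_j^{(\nu)})\in\mathcal G$ for all $i,j,\mu,\nu$; 2. (viscosity) for all $i,j,\mu$ and both choices of the sign (the same in both arguments), $\alpha_1^{LF}>\alpha_1\big(\mathbf U^{\pm,\mu}_{i+\frac12,j},\mathbf U^{\pm,\mu}_{i-\frac12,j}\big)$ and $\alpha_2^{LF}>\alpha_2\big(\mathbf U^{\mu,\pm}_{i,j+\frac12},\mathbf U^{\mu,\pm}_{i,j-\frac12}\big)$;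 3. (CFL) $0<\dfrac{\alpha_1^{LF}\Delta t}{\Delta x}+\dfrac{\alpha_2^{LF}\Delta t}{\Delta y}\le\hat\omega_1$. No discrete divergence-free condition is assumed. Then for all $i,j$ the updated density satisfies $\bar\rho^{n+1}_{ij}>0$ and, with $\bar{\mathbf v}^{n+1}_{ij}=\bar{\mathbf m}^{n+1}_{ij}/\bar\rho^{n+1}_{ij}$, $$\mathcal E(\bar{\mathbf U}^{n+1}_{ij})>-\Delta t\,\big(\bar{\mathbf v}^{n+1}_{ij}\cdot\bar{\mathbf B}^{n+1}_{ij}\big)\,\mathrm{div}_{ij}\mathbf B^n.$$ In particular, if $\mathcal E(\bar{\mathbf U}^{n+1}_{ij})\le0$, then $|\mathcal E(\bar{\mathbf U}^{n+1}_{ij})|<\Delta t\,\big(\bar{\mathbf v}^{n+1}_{ij}\cdot\bar{\mathbf B}^{n+1}_{ij}\big)\,\mathrm{div}_{ij}\mathbf B^n$. -/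

import Mathlib

open Finset

noncomputable section

namespace IdealMHD

/-! ### Conservative states of ideal MHD -/

/-- A conservative vector `U = (ρ, m₁, m₂, m₃, B₁, B₂, B₃, E)`. -/
abbrev State := Fin 8 → ℝ

/-- Assemble a conservative vector from density, momentum, magnetic field and total energy. -/
def mkState (ρ : ℝ) (m B : Fin 3 → ℝ) (E : ℝ) : State :=
  ![ρ, m 0, m 1, m 2, B 0, B 1, B 2, E]

def density (U : State) : ℝ := U 0

def momentum (U : State) : Fin 3 → ℝ := ![U 1, U 2, U 3]

def magnetic (U : State) : Fin 3 → ℝ := ![U 4, U 5, U 6]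

def totalEnergy (U : State) : ℝ := U 7

/-- Squared Euclidean length of a vector of `ℝ³`. -/
def normSq (a : Fin 3 → ℝ) : ℝ := a ⬝ᵥ a

def velocity (U : State) : Fin 3 → ℝ := fun k => momentum U k / density U

/-- The internal energy `ℰ(U) = E - (|m|² / ρ + |B|²) / 2`, that is `ρ e`. -/
def internalEnergy (U : State) : ℝ :=
  totalEnergy U - (1 / 2) * (normSq (momentum U) / density U + normSq (magnetic U))

/-- The specific internal energy `e`. -/
def specificEnergy (U : State) : ℝ := internalEnergy U / density U

/-- The set `𝒢` of admissible states. -/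
def admissibleSet : Set State := {U | 0 < density U ∧ 0 < internalEnergy U}

/-- The condition on an equation of state `p = p(ρ, e)`:
for `ρ > 0`, the specific internal energy is positive iff the pressure is. -/
def IsEOS (p : ℝ → ℝ → ℝ) : Prop := ∀ ρ e : ℝ, 0 < ρ → (0 < e ↔ 0 < p ρ e)

/-- The gas pressure of a state under the equation of state `p`. -/
def pressure (p : ℝ → ℝ → ℝ) (U : State) : ℝ := p (density U) (specificEnergy U)

/-- Gas pressure plus magnetic pressure. -/
def totalPressure (p : ℝ → ℝ → ℝ) (U : State) : ℝ := pressure p U + normSq (magnetic U) / 2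

/-- The physical flux `F_ℓ(U)`; the directions `1, 2, 3` are `0, 1, 2 : Fin 3`. -/
def flux (p : ℝ → ℝ → ℝ) (ℓ : Fin 3) (U : State) : State :=
  mkState
    (density U * velocity U ℓ)
    (fun k => density U * velocity U ℓ * velocity U k - magnetic U ℓ * magnetic U k
      + (if k = ℓ then totalPressure p U else 0))
    (fun k => velocity U ℓ * magnetic U k - magnetic U ℓ * velocity U k)
    (velocity U ℓ * (totalEnergy U + totalPressure p U)
      - magnetic U ℓ * (velocity U ⬝ᵥ magnetic U))

/-- The Lax-Friedrichs numerical flux with viscosity parameter `α`;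
the arguments `Um`, `Up` are the limiting values from the left (below) and from the right (above). -/
def lfFlux (p : ℝ → ℝ → ℝ) (ℓ : Fin 3) (α : ℝ) (Um Up : State) : State :=
  (1 / 2 : ℝ) • (flux p ℓ Um + flux p ℓ Up - α • (Up - Um))

/-! ### The lower bound for the numerical viscosity -/

/-- `𝒞_s = p / (ρ √(2 e))`. -/
def speedS (p : ℝ → ℝ → ℝ) (U : State) : ℝ :=
  pressure p U / (density U * √(2 * specificEnergy U))

/-- `𝒞_ℓ = (1/√2) [𝒞_s² + |B|²/ρ + √((𝒞_s² + |B|²/ρ)² - 4 𝒞_s² B_ℓ²/ρ)]^{1/2}`. -/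
def speedC (p : ℝ → ℝ → ℝ) (ℓ : Fin 3) (U : State) : ℝ :=
  (1 / √2) * √(speedS p U ^ 2 + normSq (magnetic U) / density U
    + √((speedS p U ^ 2 + normSq (magnetic U) / density U) ^ 2
        - 4 * (speedS p U ^ 2 * magnetic U ℓ ^ 2 / density U)))

/-- `f(U, V; σ) = |B_V - B_U| / √2 * √(σ²/ρ_U + (1-σ)²/ρ_V)`. -/
def magneticJump (U V : State) (σ : ℝ) : ℝ :=
  √(normSq (magnetic V - magnetic U)) / √2
    * √(σ ^ 2 / density U + (1 - σ) ^ 2 / density V)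

/-- `α_ℓ(U, V; σ)`. -/
def alphaAt (p : ℝ → ℝ → ℝ) (ℓ : Fin 3) (U V : State) (σ : ℝ) : ℝ :=
  max (max (|velocity U ℓ| + speedC p ℓ U) (|velocity V ℓ| + speedC p ℓ V))
      (|σ * velocity U ℓ + (1 - σ) * velocity V ℓ| + max (speedC p ℓ U) (speedC p ℓ V))
    + magneticJump U V σ

/-- `α_ℓ(U, V) = min_{σ ∈ ℝ} α_ℓ(U, V; σ)`. The function of `σ` is nonnegative and, for admissible
states, its infimum is attained. -/
def alpha (p : ℝ → ℝ → ℝ) (ℓ : Fin 3) (U V : State) : ℝ := ⨅ σ : ℝ, alphaAt p ℓ U V σ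

/-! ### Quadrature rules, on the reference interval `[-1/2, 1/2]` -/

/-- The `Q`-point Gauss quadrature rule: `Q` distinct nodes, in increasing order, with weights of
sum one, integrating exactly all polynomials of degree at most `2 Q - 1`. -/
structure GaussRule (Q : ℕ) where
  node : Fin Q → ℝ
  weight : Fin Q → ℝ
  node_strictMono : StrictMono node
  node_mem : ∀ μ, node μ ∈ Set.Icc (-1 / 2 : ℝ) (1 / 2)
  sum_weight : ∑ μ, weight μ = 1
  exact : ∀ q : Polynomial ℝ, q.natDegree < 2 * Q →
    ∑ μ, weight μ * q.eval (node μ) = ∫ s in (-1 / 2 : ℝ)..(1 / 2), q.eval s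

/-- The `L`-point Gauss-Lobatto quadrature rule: `L ≥ 2` distinct nodes, in increasing order, the
first and the last of them being the end points of the interval, with weights of sum one,
integrating exactly all polynomials of degree at most `2 L - 3`. -/
structure GaussLobattoRule (L : ℕ) where
  two_le : 2 ≤ L
  node : Fin L → ℝ
  weight : Fin L → ℝ
  node_strictMono : StrictMono node
  node_first : node ⟨0, by omega⟩ = -1 / 2
  node_last : node ⟨L - 1, by omega⟩ = 1 / 2
  sum_weight : ∑ ν, weight ν = 1
  exact : ∀ q : Polynomial ℝ, q.natDegree + 3 ≤ 2 * L →
    ∑ ν, weight ν * q.eval (node ν) = ∫ s in (-1 / 2 : ℝ)..(1 / 2), q.eval s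

/-- The weight of the first node of the Gauss-Lobatto rule. -/
def GaussLobattoRule.firstWeight {L : ℕ} (h : GaussLobattoRule L) : ℝ :=
  h.weight ⟨0, by have := h.two_le; omega⟩

/-! ### Uniform rectangular meshes and piecewise polynomial data -/

/-- A uniform rectangular mesh: the cell `(i, j)`, for `i j : ℤ`, is the rectangle with centre
`(x0 + i * dx, y0 + j * dy)` and side lengths `dx`, `dy`. -/
structure Mesh where
  x0 : ℝ
  y0 : ℝ
  dx : ℝ
  dy : ℝ
  dx_pos : 0 < dx
  dy_pos : 0 < dy

/-- The image in the interval `[x_{i-1/2}, x_{i+1/2}]` of the reference point `s ∈ [-1/2, 1/2]`. -/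
def Mesh.xAt (M : Mesh) (i : ℤ) (s : ℝ) : ℝ := M.x0 + (i : ℝ) * M.dx + s * M.dx

/-- The image in the interval `[y_{j-1/2}, y_{j+1/2}]` of the reference point `s ∈ [-1/2, 1/2]`. -/
def Mesh.yAt (M : Mesh) (j : ℤ) (s : ℝ) : ℝ := M.y0 + (j : ℝ) * M.dy + s * M.dy

/-- `x_{i+1/2}`. -/
def Mesh.xHalf (M : Mesh) (i : ℤ) : ℝ := M.x0 + ((i : ℝ) + 1 / 2) * M.dx

/-- `y_{j+1/2}`. -/
def Mesh.yHalf (M : Mesh) (j : ℤ) : ℝ := M.y0 + ((j : ℝ) + 1 / 2) * M.dy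

/-- A vector of eight polynomials in the two variables `(x, y)`. -/
abbrev PolyVec := Fin 8 → MvPolynomial (Fin 2) ℝ

/-- The state `P(x, y)`. -/
def polyEval (P : PolyVec) (x y : ℝ) : State := fun k => MvPolynomial.eval ![x, y] (P k)

/-- All components have degree at most `K`. -/
def HasDegreeLE (P : PolyVec) (K : ℕ) : Prop := ∀ k, (P k).totalDegree ≤ K

/-- The average of the polynomial vector `P` over the cell `(i, j)`. -/
def cellAverage (M : Mesh) (P : PolyVec) (i j : ℤ) : State := fun k =>
  (1 / (M.dx * M.dy)) *
    ∫ x in (M.xHalf (i - 1))..(M.xHalf i), ∫ y in (M.yHalf (j - 1))..(M.yHalf j), polyEval P x y k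

/-- `U^{-,μ}_{i+1/2,j}`, the limiting value from the cell `(i, j)`. -/
def xMinus {Q : ℕ} (M : Mesh) (g : GaussRule Q) (U : ℤ → ℤ → PolyVec) (i j : ℤ) (μ : Fin Q) :
    State :=
  polyEval (U i j) (M.xHalf i) (M.yAt j (g.node μ))

/-- `U^{+,μ}_{i+1/2,j}`, the limiting value from the cell `(i+1, j)`. -/
def xPlus {Q : ℕ} (M : Mesh) (g : GaussRule Q) (U : ℤ → ℤ → PolyVec) (i j : ℤ) (μ : Fin Q) :
    State :=
  polyEval (U (i + 1) j) (M.xHalf i) (M.yAt j (g.node μ))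

/-- `U^{μ,-}_{i,j+1/2}`, the limiting value from the cell `(i, j)`. -/
def yMinus {Q : ℕ} (M : Mesh) (g : GaussRule Q) (U : ℤ → ℤ → PolyVec) (i j : ℤ) (μ : Fin Q) :
    State :=
  polyEval (U i j) (M.xAt i (g.node μ)) (M.yHalf j)

/-- `U^{μ,+}_{i,j+1/2}`, the limiting value from the cell `(i, j+1)`. -/
def yPlus {Q : ℕ} (M : Mesh) (g : GaussRule Q) (U : ℤ → ℤ → PolyVec) (i j : ℤ) (μ : Fin Q) :
    State :=
  polyEval (U i (j + 1)) (M.xAt i (g.node μ)) (M.yHalf j)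

/-! ### The scheme -/

/-- The cell average in the cell `(i, j)` after one forward Euler step of length `dt` of the finite
volume (or discontinuous Galerkin) scheme with Lax-Friedrichs fluxes, started from the piecewise
polynomial data `U`; `α₁`, `α₂` are the viscosity parameters in the two directions. -/
def nextAverage {Q : ℕ} (p : ℝ → ℝ → ℝ) (M : Mesh) (g : GaussRule Q) (U : ℤ → ℤ → PolyVec)
    (α₁ α₂ dt : ℝ) (i j : ℤ) : State :=
  cellAverage M (U i j) i j
    - (dt / M.dx) • ∑ μ, g.weight μ •
        (lfFlux p 0 α₁ (xMinus M g U i j μ) (xPlus M g U i j μ)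
          - lfFlux p 0 α₁ (xMinus M g U (i - 1) j μ) (xPlus M g U (i - 1) j μ))
    - (dt / M.dy) • ∑ μ, g.weight μ •
        (lfFlux p 1 α₂ (yMinus M g U i j μ) (yPlus M g U i j μ)
          - lfFlux p 1 α₂ (yMinus M g U i (j - 1) μ) (yPlus M g U i (j - 1) μ))

/-- The average of the two limiting values of `B₁` at the `μ`-th Gauss node of the edge
`x = x_{i+1/2}`. -/
def meanB1 {Q : ℕ} (M : Mesh) (g : GaussRule Q) (U : ℤ → ℤ → PolyVec) (i j : ℤ) (μ : Fin Q) : ℝ :=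
  (1 / 2) * (magnetic (xMinus M g U i j μ) 0 + magnetic (xPlus M g U i j μ) 0)

/-- The average of the two limiting values of `B₂` at the `μ`-th Gauss node of the edge
`y = y_{j+1/2}`. -/
def meanB2 {Q : ℕ} (M : Mesh) (g : GaussRule Q) (U : ℤ → ℤ → PolyVec) (i j : ℤ) (μ : Fin Q) : ℝ :=
  (1 / 2) * (magnetic (yMinus M g U i j μ) 1 + magnetic (yPlus M g U i j μ) 1)

/-- The discrete divergence `div_{ij} B` of the numerical magnetic field. -/
def discreteDiv {Q : ℕ} (M : Mesh) (g : GaussRule Q) (U : ℤ → ℤ → PolyVec) (i j : ℤ) : ℝ :=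
  (∑ μ, g.weight μ * (meanB1 M g U i j μ - meanB1 M g U (i - 1) j μ)) / M.dx
    + (∑ μ, g.weight μ * (meanB2 M g U i j μ - meanB2 M g U i (j - 1) μ)) / M.dy

/-! ### Hypotheses on the data and on the viscosity parameters -/

/-- The polynomial vectors take admissible values at the points
`(x̂_i^{(ν)}, y_j^{(μ)})` and `(x_i^{(μ)}, ŷ_j^{(ν)})` of every cell, where hats mark the
Gauss-Lobatto nodes. -/
def AdmissibleAtNodes {Q L : ℕ} (M : Mesh) (g : GaussRule Q) (h : GaussLobattoRule L)
    (U : ℤ → ℤ → PolyVec) : Prop :=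
  ∀ (i j : ℤ) (μ : Fin Q) (ν : Fin L),
    polyEval (U i j) (M.xAt i (h.node ν)) (M.yAt j (g.node μ)) ∈ admissibleSet ∧
    polyEval (U i j) (M.xAt i (g.node μ)) (M.yAt j (h.node ν)) ∈ admissibleSet

/-- `α₁` and `α₂` exceed, over all cells, Gauss nodes and signs, the values
`α_1(U^{±,μ}_{i+1/2,j}, U^{±,μ}_{i-1/2,j})` and `α_2(U^{μ,±}_{i,j+1/2}, U^{μ,±}_{i,j-1/2})`
(the same sign in both arguments). -/
def ViscosityCondition {Q : ℕ} (p : ℝ → ℝ → ℝ) (M : Mesh) (g : GaussRule Q)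
    (U : ℤ → ℤ → PolyVec) (α₁ α₂ : ℝ) : Prop :=
  ∀ (i j : ℤ) (μ : Fin Q),
    alpha p 0 (xMinus M g U i j μ) (xMinus M g U (i - 1) j μ) < α₁ ∧
    alpha p 0 (xPlus M g U i j μ) (xPlus M g U (i - 1) j μ) < α₁ ∧
    alpha p 1 (yMinus M g U i j μ) (yMinus M g U i (j - 1) μ) < α₂ ∧
    alpha p 1 (yPlus M g U i j μ) (yPlus M g U i (j - 1) μ) < α₂

end IdealMHD

end

open IdealMHD

noncomputable section

/-! Internal energy is not linear in the state, but it can be tested by linear functionals. For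
fixed `v`, `B`, the functional `entropyForm v B` plus the constant `normSq B / 2` equals `ρ|v_U -
v|²/2 + ρe + |B_U - B|²/2`. It is positive on admissible states, and at `v = v_U`, `B = B_U` it is
the internal energy of `U`.

The analytic core is `entropyForm_splitting_pos`: for a pair of admissible states, viscosity above
`alpha` dominates the flux difference tested by this functional, except for `(v ⬝ᵥ B)` times the
jump of the normal magnetic component. Two estimates carry it: `coupling_sq_le`, where the fast
speed appears as an eigenvalue, and `abs_jump_le`, which pays for differing magnetic fields.

For the scheme, the cell average is a quadrature sum with admissible point values. Under the CFL
condition its boundary nodes outweigh the Lax–Friedrichs terms, leaving half-sums of splittings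
between opposite edges with limits of the same sign. The uncontrolled jumps add up to the discrete
divergence. This is `SplittingFunctional.nextAverage_pos`, applied to the density (no source) and to
`entropyForm` with `v`, `B` frozen at the updated average. -/

namespace IdealMHD

/-! ### Estimates behind the viscosity bound -/

/-- The fast speed bounds the bilinear coupling between velocity and magnetic perturbations. -/
theorem coupling_sq_le (c β₁ β₂ β₃ W₁ W₂ W₃ S l : ℝ)
    (hS : S = c ^ 2 + β₁ ^ 2 + β₂ ^ 2 + β₃ ^ 2)
    (hl : l = (S + √(S ^ 2 - 4 * (c ^ 2 * β₁ ^ 2))) / 2) :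
    (c * W₁) ^ 2 + (β₂ * W₁ - β₁ * W₂) ^ 2 + (β₃ * W₁ - β₁ * W₃) ^ 2
      ≤ l * (W₁ ^ 2 + W₂ ^ 2 + W₃ ^ 2) := by
  have hD : 0 ≤ S ^ 2 - 4 * (c ^ 2 * β₁ ^ 2) := by
    have h1 : S ^ 2 - 4 * (c ^ 2 * β₁ ^ 2)
        = (c ^ 2 - β₁ ^ 2 + (β₂ ^ 2 + β₃ ^ 2)) ^ 2 + 4 * β₁ ^ 2 * (β₂ ^ 2 + β₃ ^ 2) := by
      rw [hS]; ring
    rw [h1]; positivity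
  have hsq := Real.sq_sqrt hD
  have hr := Real.sqrt_nonneg (S ^ 2 - 4 * (c ^ 2 * β₁ ^ 2))
  set r := √(S ^ 2 - 4 * (c ^ 2 * β₁ ^ 2)) with hrdef
  have hchar : l ^ 2 - S * l + c ^ 2 * β₁ ^ 2 = 0 := by
    rw [hl]; linear_combination (1 / 4) * hsq
  have hSl : S ≤ 2 * l := by rw [hl]; linarith
  -- The left side is a quadratic form in `W`. Besides `β₁ ^ 2`, its eigenvalues are the roots of
  -- this equation, and `l` is the larger one.
  have hdet : (l - β₁ ^ 2) * (l - c ^ 2 - β₂ ^ 2 - β₃ ^ 2) = β₁ ^ 2 * (β₂ ^ 2 + β₃ ^ 2) := by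
    rw [hS] at hchar; linear_combination hchar
  -- The two factors in `hdet` have sum `2 * l - S ≥ 0`, so a negative first factor would make their
  -- product negative.
  have hge : β₁ ^ 2 ≤ l := by
    by_contra! hlt
    have h2 : 0 < l - c ^ 2 - β₂ ^ 2 - β₃ ^ 2 := by linarith
    have h3 : (l - β₁ ^ 2) * (l - c ^ 2 - β₂ ^ 2 - β₃ ^ 2) < 0 :=
      mul_neg_of_neg_of_pos (by linarith) h2
    have h4 : 0 ≤ β₁ ^ 2 * (β₂ ^ 2 + β₃ ^ 2) := by positivity
    linarith
  rcases hge.eq_or_lt with heq | hlt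
  · have h0 : β₁ ^ 2 * (β₂ ^ 2 + β₃ ^ 2) = 0 := by rw [← hdet, ← heq]; ring
    have hcross : β₁ * β₂ = 0 ∧ β₁ * β₃ = 0 := by
      constructor <;> apply pow_eq_zero_iff (two_ne_zero) |>.1 <;>
        nlinarith [sq_nonneg (β₁ * β₂), sq_nonneg (β₁ * β₃)]
    have hW : 0 ≤ (l - c ^ 2 - β₂ ^ 2 - β₃ ^ 2) * W₁ ^ 2 :=
      mul_nonneg (by linarith) (sq_nonneg _)
    have e : l * (W₁ ^ 2 + W₂ ^ 2 + W₃ ^ 2) - ((c * W₁) ^ 2 + (β₂ * W₁ - β₁ * W₂) ^ 2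
        + (β₃ * W₁ - β₁ * W₃) ^ 2) = (l - c ^ 2 - β₂ ^ 2 - β₃ ^ 2) * W₁ ^ 2 := by
      linear_combination 2 * W₁ * W₂ * hcross.1 + 2 * W₁ * W₃ * hcross.2
        - (W₂ ^ 2 + W₃ ^ 2) * heq
    linarith
  · have hpos : 0 < l - β₁ ^ 2 := by linarith
    -- Completing the squares in `W₂` and `W₃`; `hdet` cancels what remains of `W₁ ^ 2`.
    have e : (l - β₁ ^ 2) * (l * (W₁ ^ 2 + W₂ ^ 2 + W₃ ^ 2) - ((c * W₁) ^ 2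
        + (β₂ * W₁ - β₁ * W₂) ^ 2 + (β₃ * W₁ - β₁ * W₃) ^ 2))
        = ((l - β₁ ^ 2) * W₂ + β₁ * W₁ * β₂) ^ 2 + ((l - β₁ ^ 2) * W₃ + β₁ * W₁ * β₃) ^ 2 := by
      linear_combination W₁ ^ 2 * hdet
    have h5 : 0 ≤ (l - β₁ ^ 2) * (l * (W₁ ^ 2 + W₂ ^ 2 + W₃ ^ 2) - ((c * W₁) ^ 2
        + (β₂ * W₁ - β₁ * W₂) ^ 2 + (β₃ * W₁ - β₁ * W₃) ^ 2)) := by rw [e]; positivity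
    have := nonneg_of_mul_nonneg_right h5 hpos
    linarith

/-- Cauchy–Schwarz separates `(s, b₂, b₃)` from the vector bounded in `coupling_sq_le`; then `P * T
≤ ((P + T) / 2) ^ 2`. -/
theorem abs_coupling_le (c β₁ β₂ β₃ W₁ W₂ W₃ s b₂ b₃ S : ℝ)
    (hS : S = c ^ 2 + β₁ ^ 2 + β₂ ^ 2 + β₃ ^ 2) :
    |c * W₁ * s + (β₂ * W₁ - β₁ * W₂) * b₂ + (β₃ * W₁ - β₁ * W₃) * b₃|
      ≤ (1 / √2) * √(S + √(S ^ 2 - 4 * (c ^ 2 * β₁ ^ 2)))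
        * ((W₁ ^ 2 + W₂ ^ 2 + W₃ ^ 2 + (s ^ 2 + b₂ ^ 2 + b₃ ^ 2)) / 2) := by
  have hS0 : 0 ≤ S := by rw [hS]; positivity
  have h := coupling_sq_le c β₁ β₂ β₃ W₁ W₂ W₃ S _ hS rfl
  set r := S + √(S ^ 2 - 4 * (c ^ 2 * β₁ ^ 2)) with hr
  have hr0 : 0 ≤ r := by positivity
  set P := W₁ ^ 2 + W₂ ^ 2 + W₃ ^ 2
  set T := s ^ 2 + b₂ ^ 2 + b₃ ^ 2 with hT
  have hP : 0 ≤ P := by positivity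
  have hT0 : 0 ≤ T := by positivity
  apply abs_le_of_sq_le_sq _ (by positivity)
  have hcs : (c * W₁ * s + (β₂ * W₁ - β₁ * W₂) * b₂ + (β₃ * W₁ - β₁ * W₃) * b₃) ^ 2
      ≤ ((c * W₁) ^ 2 + (β₂ * W₁ - β₁ * W₂) ^ 2 + (β₃ * W₁ - β₁ * W₃) ^ 2) * T := by
    generalize c * W₁ = x
    generalize β₂ * W₁ - β₁ * W₂ = y
    generalize β₃ * W₁ - β₁ * W₃ = z
    rw [hT]
    nlinarith [sq_nonneg (x * b₂ - y * s), sq_nonneg (x * b₃ - z * s), sq_nonneg (y * b₃ - z * b₂)]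
  have h1 : ((1 / √2) * √r * ((P + T) / 2)) ^ 2 = r / 2 * ((P + T) / 2) ^ 2 := by
    rw [mul_pow, mul_pow, Real.sq_sqrt hr0, div_pow, Real.sq_sqrt zero_le_two]; ring
  rw [h1]
  calc _ ≤ _ := hcs
    _ ≤ r / 2 * P * T := mul_le_mul_of_nonneg_right h hT0
    _ = r / 2 * (P * T) := by ring
    _ ≤ r / 2 * ((P + T) / 2) ^ 2 := by
        apply mul_le_mul_of_nonneg_left _ (by positivity)
        nlinarith [sq_nonneg (P - T)]

/-- Rescaling by `√ρ` turns the remainder into the coupling of `abs_coupling_le`, with `√ρ * √(2 *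
e)` as an extra variable so that thermal energy shares the bound. The terms in `b₁` cancel on the
left, so `b₁ ^ 2` on the right is slack. -/
theorem abs_flux_remainder_le (ρ e p B₁ B₂ B₃ w₁ w₂ w₃ b₁ b₂ b₃ N : ℝ) (hρ : 0 < ρ) (he : 0 < e)
    (hN : N = B₁ ^ 2 + B₂ ^ 2 + B₃ ^ 2) :
    |p * w₁ + (B₁ * b₁ + B₂ * b₂ + B₃ * b₃) * w₁ - B₁ * (w₁ * b₁ + w₂ * b₂ + w₃ * b₃)|
      ≤ (1 / √2) * √((p / (ρ * √(2 * e))) ^ 2 + N / ρ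
          + √(((p / (ρ * √(2 * e))) ^ 2 + N / ρ) ^ 2
            - 4 * ((p / (ρ * √(2 * e))) ^ 2 * B₁ ^ 2 / ρ)))
        * (ρ * (w₁ ^ 2 + w₂ ^ 2 + w₃ ^ 2) / 2 + ρ * e + (b₁ ^ 2 + b₂ ^ 2 + b₃ ^ 2) / 2) := by
  have hr : 0 < √ρ := Real.sqrt_pos.2 hρ
  have hs : 0 < √(2 * e) := Real.sqrt_pos.2 (by linarith)
  have hr2 : √ρ ^ 2 = ρ := Real.sq_sqrt hρ.le
  have hs2 : √(2 * e) ^ 2 = 2 * e := Real.sq_sqrt (by linarith)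
  set r := √ρ
  set s := √(2 * e)
  rw [mul_div_assoc _ (B₁ ^ 2) ρ]
  set c := p / (ρ * s) with hc
  have hcp : c * (r * r) * s = p := by
    rw [hc, ← pow_two, hr2]; field_simp
  have hB : ∀ x : ℝ, (x / r) ^ 2 = x ^ 2 / ρ := fun x => by rw [div_pow, hr2]
  have h := abs_coupling_le c (B₁ / r) (B₂ / r) (B₃ / r) (r * w₁) (r * w₂) (r * w₃) (r * s) b₂ b₃
    (c ^ 2 + N / ρ) (by rw [hB, hB, hB, hN]; ring)
  rw [hB] at h
  have e1 : c * (r * w₁) * (r * s) + (B₂ / r * (r * w₁) - B₁ / r * (r * w₂)) * b₂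
      + (B₃ / r * (r * w₁) - B₁ / r * (r * w₃)) * b₃
      = p * w₁ + (B₁ * b₁ + B₂ * b₂ + B₃ * b₃) * w₁ - B₁ * (w₁ * b₁ + w₂ * b₂ + w₃ * b₃) := by
    rw [← hcp]; field_simp; ring
  rw [e1] at h
  refine h.trans (mul_le_mul_of_nonneg_left ?_ (by positivity))
  rw [mul_pow, mul_pow, mul_pow, mul_pow, hr2, hs2]
  nlinarith [sq_nonneg b₁]

/-- Source of `magneticJump` in the viscosity. Weighted Cauchy–Schwarz bounds the averaged velocity
perturbation by kinetic energy, `h` bounds the magnetic difference, and the product is absorbed by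
`4 * X * Y ≤ (X + Y) ^ 2`. -/
theorem abs_jump_le (J σ ρ ρ' w w' X X' Y Y' : ℝ) (hρ : 0 < ρ) (hρ' : 0 < ρ')
    (hX : ρ * w ^ 2 ≤ 2 * X) (hX' : ρ' * w' ^ 2 ≤ 2 * X') (hY : 0 ≤ Y) (hY' : 0 ≤ Y')
    (hJ : 0 ≤ J) (h : (Y - Y') ^ 2 ≤ J * (Y + Y')) :
    |(σ * w + (1 - σ) * w') * (Y - Y')|
      ≤ √J / √2 * √(σ ^ 2 / ρ + (1 - σ) ^ 2 / ρ') * (X + Y + (X' + Y')) := by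
  have hX0 : 0 ≤ X := by nlinarith [mul_nonneg hρ.le (sq_nonneg w)]
  have hX0' : 0 ≤ X' := by nlinarith [mul_nonneg hρ'.le (sq_nonneg w')]
  have hg : 0 ≤ σ ^ 2 / ρ + (1 - σ) ^ 2 / ρ' := by positivity
  have hcs : (σ * w + (1 - σ) * w') ^ 2
      ≤ (σ ^ 2 / ρ + (1 - σ) ^ 2 / ρ') * (ρ * w ^ 2 + ρ' * w' ^ 2) := by
    have e : (σ ^ 2 / ρ + (1 - σ) ^ 2 / ρ') * (ρ * w ^ 2 + ρ' * w' ^ 2)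
        - (σ * w + (1 - σ) * w') ^ 2 = (σ * ρ' * w' - (1 - σ) * ρ * w) ^ 2 / (ρ * ρ') := by
      field_simp; ring
    have : 0 ≤ (σ * ρ' * w' - (1 - σ) * ρ * w) ^ 2 / (ρ * ρ') := by positivity
    linarith
  set g := σ ^ 2 / ρ + (1 - σ) ^ 2 / ρ'
  apply abs_le_of_sq_le_sq _ (by positivity)
  rw [mul_pow, mul_pow, mul_pow, Real.sq_sqrt hg, div_pow, Real.sq_sqrt zero_le_two,
    Real.sq_sqrt hJ]
  have h1 : (σ * w + (1 - σ) * w') ^ 2 ≤ g * (2 * (X + X')) :=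
    hcs.trans (mul_le_mul_of_nonneg_left (by linarith) hg)
  calc _ ≤ g * (2 * (X + X')) * (J * (Y + Y')) := by gcongr
    _ = J / 2 * g * (4 * ((X + X') * (Y + Y'))) := by ring
    _ ≤ J / 2 * g * (X + Y + (X' + Y')) ^ 2 := by
      apply mul_le_mul_of_nonneg_left _ (by positivity)
      nlinarith [sq_nonneg (X + X' - (Y + Y'))]

/-- Factor the difference of squares as an inner product of difference and sum, apply
Cauchy–Schwarz, and bound the sum by the parallelogram law. -/
theorem sq_normSq_sub_le (a b c : Fin 3 → ℝ) :
    (normSq (a - c) / 2 - normSq (b - c) / 2) ^ 2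
      ≤ normSq (b - a) * (normSq (a - c) / 2 + normSq (b - c) / 2) := by
  simp only [normSq, dotProduct, Fin.sum_univ_three, Pi.sub_apply]
  generalize hx : a 0 - c 0 = x₀
  generalize hy : a 1 - c 1 = x₁
  generalize hz : a 2 - c 2 = x₂
  have h0 : b 0 - a 0 = (b 0 - c 0) - x₀ := by rw [← hx]; ring
  have h1 : b 1 - a 1 = (b 1 - c 1) - x₁ := by rw [← hy]; ring
  have h2 : b 2 - a 2 = (b 2 - c 2) - x₂ := by rw [← hz]; ring
  rw [h0, h1, h2]
  generalize b 0 - c 0 = y₀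
  generalize b 1 - c 1 = y₁
  generalize b 2 - c 2 = y₂
  have hcs : ((y₀ - x₀) * (y₀ + x₀) + (y₁ - x₁) * (y₁ + x₁) + (y₂ - x₂) * (y₂ + x₂)) ^ 2
      ≤ ((y₀ - x₀) ^ 2 + (y₁ - x₁) ^ 2 + (y₂ - x₂) ^ 2)
        * ((y₀ + x₀) ^ 2 + (y₁ + x₁) ^ 2 + (y₂ + x₂) ^ 2) := by
    generalize y₀ - x₀ = d₀
    generalize y₁ - x₁ = d₁
    generalize y₂ - x₂ = d₂
    generalize y₀ + x₀ = s₀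
    generalize y₁ + x₁ = s₁
    generalize y₂ + x₂ = s₂
    nlinarith [sq_nonneg (d₀ * s₁ - d₁ * s₀), sq_nonneg (d₀ * s₂ - d₂ * s₀),
      sq_nonneg (d₁ * s₂ - d₂ * s₁)]
  have hpar : (y₀ + x₀) ^ 2 + (y₁ + x₁) ^ 2 + (y₂ + x₂) ^ 2
      ≤ 2 * (x₀ ^ 2 + x₁ ^ 2 + x₂ ^ 2 + (y₀ ^ 2 + y₁ ^ 2 + y₂ ^ 2)) := by
    nlinarith [sq_nonneg (y₀ - x₀), sq_nonneg (y₁ - x₁), sq_nonneg (y₂ - x₂)]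
  have h := hcs.trans (mul_le_mul_of_nonneg_left hpar (by positivity))
  linarith

/-! ### Linear test functionals and the splitting property -/

/-- `|v*|²/2 ρ - v*·m - B*·B + E`. -/
def entropyForm (v B : Fin 3 → ℝ) : State →ₗ[ℝ] ℝ where
  toFun U := normSq v / 2 * density U - v ⬝ᵥ momentum U - B ⬝ᵥ magnetic U + totalEnergy U
  map_add' U V := by
    simp [density, momentum, magnetic, totalEnergy, dotProduct, Fin.sum_univ_three]; ring
  map_smul' c U := by
    simp [density, momentum, magnetic, totalEnergy, dotProduct, Fin.sum_univ_three]; ring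

theorem entropyForm_apply (v B : Fin 3 → ℝ) (U : State) : entropyForm v B U =
    normSq v / 2 * density U - v ⬝ᵥ momentum U - B ⬝ᵥ magnetic U + totalEnergy U := rfl

theorem momentum_eq {U : State} (hU : density U ≠ 0) (k : Fin 3) :
    momentum U k = density U * velocity U k := by
  rw [velocity]; field_simp

theorem totalEnergy_eq {U : State} (hU : density U ≠ 0) : totalEnergy U =
    density U * normSq (velocity U) / 2 + density U * specificEnergy U
      + normSq (magnetic U) / 2 := by
  simp only [specificEnergy, internalEnergy, normSq, dotProduct, Fin.sum_univ_three, velocity]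
  field_simp; ring

theorem entropyForm_eq {U : State} (hU : density U ≠ 0) (v B : Fin 3 → ℝ) :
    entropyForm v B U + normSq B / 2 =
      density U * normSq (velocity U - v) / 2 + density U * specificEnergy U
        + normSq (magnetic U - B) / 2 := by
  rw [entropyForm_apply, totalEnergy_eq hU]
  simp only [normSq, dotProduct, Fin.sum_univ_three, momentum_eq hU, Pi.sub_apply]
  ring

/-- Isolates what needs control. The term `v ℓ * normSq B / 2` is the same for every state and
cancels in flux differences, `magnetic U ℓ * (v ⬝ᵥ B)` is matched by the source, and the last
bracket is bounded by the fast speed. -/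
theorem entropyForm_flux (p : ℝ → ℝ → ℝ) (ℓ : Fin 3) {U : State} (hU : density U ≠ 0)
    (v B : Fin 3 → ℝ) :
    entropyForm v B (flux p ℓ U) = magnetic U ℓ * (v ⬝ᵥ B) - v ℓ * normSq B / 2
      + velocity U ℓ * (density U * normSq (velocity U - v) / 2 + density U * specificEnergy U)
      + v ℓ * (normSq (magnetic U - B) / 2)
      + (pressure p U * (velocity U - v) ℓ
        + (magnetic U ⬝ᵥ (magnetic U - B)) * (velocity U - v) ℓ
        - magnetic U ℓ * ((velocity U - v) ⬝ᵥ (magnetic U - B))) := by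
  have hd : density (flux p ℓ U) = density U * velocity U ℓ := rfl
  have hE : totalEnergy (flux p ℓ U) = velocity U ℓ * (totalEnergy U + totalPressure p U)
      - magnetic U ℓ * (velocity U ⬝ᵥ magnetic U) := rfl
  have hm : ∀ k, momentum (flux p ℓ U) k = density U * velocity U ℓ * velocity U k
      - magnetic U ℓ * magnetic U k + (if k = ℓ then totalPressure p U else 0) := by
    intro k; fin_cases k <;> rfl
  have hB : ∀ k, magnetic (flux p ℓ U) k
      = velocity U ℓ * magnetic U k - magnetic U ℓ * velocity U k := by
    intro k; fin_cases k <;> rfl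
  rw [entropyForm_apply, hd, hE, totalEnergy_eq hU, totalPressure]
  simp only [dotProduct, hm, hB, mul_add, Finset.sum_add_distrib, mul_ite, mul_zero,
    Finset.sum_ite_eq', Finset.mem_univ, if_true]
  simp only [normSq, dotProduct, Fin.sum_univ_three, Pi.sub_apply, totalPressure]
  ring

theorem specificEnergy_pos {U : State} (hU : U ∈ admissibleSet) : 0 < specificEnergy U :=
  div_pos hU.2 hU.1

theorem normSq_nonneg (a : Fin 3 → ℝ) : 0 ≤ normSq a := by
  simp only [normSq, dotProduct, Fin.sum_univ_three]
  nlinarith [sq_nonneg (a 0), sq_nonneg (a 1), sq_nonneg (a 2)]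

theorem speedC_nonneg (p : ℝ → ℝ → ℝ) (ℓ : Fin 3) (U : State) : 0 ≤ speedC p ℓ U := by
  unfold speedC; positivity

theorem magneticJump_nonneg (U V : State) (σ : ℝ) : 0 ≤ magneticJump U V σ := by
  unfold magneticJump; positivity

theorem abs_velocity_le_alphaAt (p : ℝ → ℝ → ℝ) (ℓ : Fin 3) (U V : State) (σ : ℝ) :
    |velocity U ℓ| ≤ alphaAt p ℓ U V σ ∧ |velocity V ℓ| ≤ alphaAt p ℓ U V σ := by
  have hf := magneticJump_nonneg U V σ
  have hU := speedC_nonneg p ℓ U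
  have hV := speedC_nonneg p ℓ V
  have h1 := (le_max_left (|velocity U ℓ| + speedC p ℓ U) (|velocity V ℓ| + speedC p ℓ V)).trans
    (le_max_left _ (|σ * velocity U ℓ + (1 - σ) * velocity V ℓ|
      + max (speedC p ℓ U) (speedC p ℓ V)))
  have h2 := (le_max_right (|velocity U ℓ| + speedC p ℓ U) (|velocity V ℓ| + speedC p ℓ V)).trans
    (le_max_left _ (|σ * velocity U ℓ + (1 - σ) * velocity V ℓ|
      + max (speedC p ℓ U) (speedC p ℓ V)))
  unfold alphaAt
  constructor <;> linarith

theorem alpha_nonneg (p : ℝ → ℝ → ℝ) (ℓ : Fin 3) (U V : State) : 0 ≤ alpha p ℓ U V :=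
  Real.iInf_nonneg fun σ => (abs_nonneg _).trans (abs_velocity_le_alphaAt p ℓ U V σ).1

theorem abs_remainder_le_speedC (p : ℝ → ℝ → ℝ) (ℓ : Fin 3) {U : State} (hU : U ∈ admissibleSet)
    (w b : Fin 3 → ℝ) :
    |pressure p U * w ℓ + (magnetic U ⬝ᵥ b) * w ℓ - magnetic U ℓ * (w ⬝ᵥ b)|
      ≤ speedC p ℓ U
        * (density U * normSq w / 2 + density U * specificEnergy U + normSq b / 2) := by
  have he := specificEnergy_pos hU
  -- The scalar estimate singles out the first component, so the axes are permuted to put `ℓ` first.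
  have key := fun i j k : Fin 3 => abs_flux_remainder_le (density U) (specificEnergy U)
    (pressure p U) (magnetic U i) (magnetic U j) (magnetic U k) (w i) (w j) (w k) (b i) (b j) (b k)
    (normSq (magnetic U)) hU.1 he
  unfold speedC speedS
  have hN : ∀ a : Fin 3 → ℝ, normSq a = a 0 ^ 2 + a 1 ^ 2 + a 2 ^ 2 := fun a => by
    simp only [normSq, dotProduct, Fin.sum_univ_three]; ring
  have hd : ∀ a b : Fin 3 → ℝ, a ⬝ᵥ b = a 0 * b 0 + a 1 * b 1 + a 2 * b 2 := fun a b => by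
    simp only [dotProduct, Fin.sum_univ_three]
  rw [hN w, hN b, hd, hd]
  obtain rfl | rfl | rfl : ℓ = 0 ∨ ℓ = 1 ∨ ℓ = 2 := by fin_cases ℓ <;> simp
  · exact key 0 1 2 (hN _)
  · convert key 1 0 2 (by rw [hN]; ring) using 2 <;> ring
  · convert key 2 0 1 (by rw [hN]; ring) using 2 <;> ring

/-- The generalized Lax-Friedrichs splitting property. -/
theorem entropyForm_splitting_pos (p : ℝ → ℝ → ℝ) (ℓ : Fin 3) {U V : State}
    (hU : U ∈ admissibleSet) (hV : V ∈ admissibleSet) {α : ℝ} (hα : alpha p ℓ U V < α)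
    (v B : Fin 3 → ℝ) :
    0 < α * (entropyForm v B U + normSq B / 2) + α * (entropyForm v B V + normSq B / 2)
      - entropyForm v B (flux p ℓ U) + entropyForm v B (flux p ℓ V)
      + (v ⬝ᵥ B) * (magnetic U ℓ - magnetic V ℓ) := by
  obtain ⟨σ, hσ⟩ := exists_lt_of_ciInf_lt hα
  have hρ := hU.1
  have hρ' := hV.1
  rw [entropyForm_eq hρ.ne', entropyForm_eq hρ'.ne', entropyForm_flux p ℓ hρ.ne',
    entropyForm_flux p ℓ hρ'.ne']
  have hR := abs_remainder_le_speedC p ℓ hU (velocity U - v) (magnetic U - B)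
  have hR' := abs_remainder_le_speedC p ℓ hV (velocity V - v) (magnetic V - B)
  have hw : ∀ a : Fin 3 → ℝ, a ℓ ^ 2 ≤ normSq a := fun a => by
    rw [pow_two]
    exact Finset.single_le_sum (f := fun k => a k * a k) (fun k _ => mul_self_nonneg _)
      (Finset.mem_univ ℓ)
  have heU := mul_pos hρ (specificEnergy_pos hU)
  have heV := mul_pos hρ' (specificEnergy_pos hV)
  have hX0 := mul_nonneg hρ.le (normSq_nonneg (velocity U - v))
  have hX0' := mul_nonneg hρ'.le (normSq_nonneg (velocity V - v))
  have hX1 := mul_le_mul_of_nonneg_left (hw (velocity U - v)) hρ.le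
  have hX1' := mul_le_mul_of_nonneg_left (hw (velocity V - v)) hρ'.le
  have hY0 := normSq_nonneg (magnetic U - B)
  have hY0' := normSq_nonneg (magnetic V - B)
  have hj := abs_jump_le (normSq (magnetic V - magnetic U)) σ (density U) (density V)
    ((velocity U - v) ℓ) ((velocity V - v) ℓ)
    (density U * normSq (velocity U - v) / 2 + density U * specificEnergy U)
    (density V * normSq (velocity V - v) / 2 + density V * specificEnergy V)
    (normSq (magnetic U - B) / 2) (normSq (magnetic V - B) / 2) hρ hρ'
    (by linarith) (by linarith) (by linarith) (by linarith)
    (normSq_nonneg _) (sq_normSq_sub_le _ _ _)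
  change _ ≤ magneticJump U V σ * _ at hj
  unfold alphaAt at hσ
  have hA1 := (le_max_left (|velocity U ℓ| + speedC p ℓ U) (|velocity V ℓ| + speedC p ℓ V)).trans
    (le_max_left _ (|σ * velocity U ℓ + (1 - σ) * velocity V ℓ|
      + max (speedC p ℓ U) (speedC p ℓ V)))
  have hA2 := (le_max_right (|velocity U ℓ| + speedC p ℓ U) (|velocity V ℓ| + speedC p ℓ V)).trans
    (le_max_left _ (|σ * velocity U ℓ + (1 - σ) * velocity V ℓ|
      + max (speedC p ℓ U) (speedC p ℓ V)))
  have hA3 := le_max_right (max (|velocity U ℓ| + speedC p ℓ U) (|velocity V ℓ| + speedC p ℓ V))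
    (|σ * velocity U ℓ + (1 - σ) * velocity V ℓ| + max (speedC p ℓ U) (speedC p ℓ V))
  have hC1 := le_max_left (speedC p ℓ U) (speedC p ℓ V)
  have hC2 := le_max_right (speedC p ℓ U) (speedC p ℓ V)
  set A := max (max (|velocity U ℓ| + speedC p ℓ U) (|velocity V ℓ| + speedC p ℓ V))
    (|σ * velocity U ℓ + (1 - σ) * velocity V ℓ| + max (speedC p ℓ U) (speedC p ℓ V))
  simp only [Pi.sub_apply] at *
  have hX : 0 < density U * normSq (velocity U - v) / 2 + density U * specificEnergy U := by
    linarith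
  have hX' : 0 < density V * normSq (velocity V - v) / 2 + density V * specificEnergy V := by
    linarith
  have hY : 0 ≤ normSq (magnetic U - B) / 2 := by linarith
  have hY' : 0 ≤ normSq (magnetic V - B) / 2 := by linarith
  generalize density U * normSq (velocity U - v) / 2 + density U * specificEnergy U = X at *
  generalize density V * normSq (velocity V - v) / 2 + density V * specificEnergy V = X' at *
  generalize normSq (magnetic U - B) / 2 = Y at *
  generalize normSq (magnetic V - B) / 2 = Y' at *
  generalize pressure p U * (velocity U ℓ - v ℓ)
    + (magnetic U ⬝ᵥ (magnetic U - B)) * (velocity U ℓ - v ℓ)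
    - magnetic U ℓ * ((velocity U - v) ⬝ᵥ (magnetic U - B)) = R at *
  generalize pressure p V * (velocity V ℓ - v ℓ)
    + (magnetic V ⬝ᵥ (magnetic V - B)) * (velocity V ℓ - v ℓ)
    - magnetic V ℓ * ((velocity V - v) ⬝ᵥ (magnetic V - B)) = R' at *
  generalize velocity U ℓ = a at *
  generalize velocity V ℓ = a' at *
  generalize speedC p ℓ U = C at *
  generalize speedC p ℓ V = C' at *
  generalize magneticJump U V σ = f at *
  have hjl := (abs_le.1 hj).1
  have hRl := (abs_le.1 hR).2
  have hRl' := (abs_le.1 hR').1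
  -- The leftover `v ℓ * (Y - Y')` is handled by writing `v ℓ` as the `σ`-average of `a`, `a'` minus
  -- that of the perturbations `a - v ℓ`, `a' - v ℓ`. The former is bounded by `m3`, `m4`, the
  -- latter by `hjl`; the part `C` withheld from `A` absorbs `R`, and likewise `C'` absorbs `R'`.
  have m1 : a * X ≤ (A - C) * X := mul_le_mul_of_nonneg_right (by linarith [le_abs_self a]) hX.le
  have m2 : -a' * X' ≤ (A - C') * X' :=
    mul_le_mul_of_nonneg_right (by linarith [neg_le_abs a']) hX'.le
  have m3 : (σ * a + (1 - σ) * a') * Y ≤ (A - C) * Y :=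
    mul_le_mul_of_nonneg_right (by linarith [le_abs_self (σ * a + (1 - σ) * a')]) hY
  have m4 : -(σ * a + (1 - σ) * a') * Y' ≤ (A - C') * Y' :=
    mul_le_mul_of_nonneg_right (by linarith [neg_le_abs (σ * a + (1 - σ) * a')]) hY'
  have m5 : (A + f) * (X + Y + (X' + Y')) < α * (X + Y + (X' + Y')) :=
    mul_lt_mul_of_pos_right hσ (by linarith)
  linarith

theorem density_splitting_pos (p : ℝ → ℝ → ℝ) (ℓ : Fin 3) {U V : State}
    (hU : U ∈ admissibleSet) (hV : V ∈ admissibleSet) {α : ℝ} (hα : alpha p ℓ U V < α) :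
    0 < α * density U + α * density V - density (flux p ℓ U) + density (flux p ℓ V) := by
  obtain ⟨σ, hσ⟩ := exists_lt_of_ciInf_lt hα
  obtain ⟨h1, h2⟩ := abs_velocity_le_alphaAt p ℓ U V σ
  have hd : ∀ W, density (flux p ℓ W) = density W * velocity W ℓ := fun _ => rfl
  rw [hd, hd]
  have m1 := mul_pos hU.1 (show 0 < α - velocity U ℓ by linarith [le_abs_self (velocity U ℓ)])
  have m2 := mul_pos hV.1 (show 0 < α + velocity V ℓ by linarith [neg_le_abs (velocity V ℓ)])
  linarith

/-! ### Signs and comparison of quadrature weights -/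

open Polynomial in
/-- The monic polynomial with simple roots at `x k`, `k ∈ s`. -/
def nodal {ι : Type*} (x : ι → ℝ) (s : Finset ι) : ℝ[X] := ∏ k ∈ s, (X - C (x k))

theorem natDegree_nodal {ι : Type*} (x : ι → ℝ) (s : Finset ι) : (nodal x s).natDegree = #s :=
  Polynomial.natDegree_finsetProd_X_sub_C_eq_card s x

theorem eval_nodal {ι : Type*} (x : ι → ℝ) (s : Finset ι) (t : ℝ) :
    (nodal x s).eval t = ∏ k ∈ s, (t - x k) := by
  simp [nodal, Polynomial.eval_prod]

theorem eval_nodal_of_mem {ι : Type*} (x : ι → ℝ) {s : Finset ι} {k : ι} (hk : k ∈ s) :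
    (nodal x s).eval (x k) = 0 := by
  rw [eval_nodal]; exact Finset.prod_eq_zero hk (sub_self _)

theorem eval_nodal_ne_zero {ι : Type*} {x : ι → ℝ} (hx : Function.Injective x) {s : Finset ι}
    {k : ι} (hk : k ∉ s) : (nodal x s).eval (x k) ≠ 0 := by
  rw [eval_nodal, Finset.prod_ne_zero_iff]
  intro m hm h0
  exact hk (hx (sub_eq_zero.1 h0) ▸ hm)

/-- Test the rule on the square of the polynomial vanishing at all other nodes; its degree `2 * Q -
2` is within the exactness range. -/
theorem GaussRule.weight_nonneg {Q : ℕ} (g : GaussRule Q) (μ : Fin Q) : 0 ≤ g.weight μ := by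
  have hQ : 0 < Q := μ.pos
  have hne := eval_nodal_ne_zero g.node_strictMono.injective (Finset.notMem_erase μ univ)
  have h := g.exact (nodal g.node (univ.erase μ) ^ 2) (by
    rw [Polynomial.natDegree_pow, natDegree_nodal, Finset.card_erase_of_mem (mem_univ _),
      Finset.card_univ, Fintype.card_fin]
    omega)
  rw [Finset.sum_eq_single μ] at h
  · have h2 : 0 ≤ ∫ s in (-1 / 2 : ℝ)..(1 / 2), (nodal g.node (univ.erase μ) ^ 2).eval s :=
      intervalIntegral.integral_nonneg (by norm_num) fun s _ => by
        rw [Polynomial.eval_pow]; positivity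
    rw [← h, Polynomial.eval_pow] at h2
    exact nonneg_of_mul_nonneg_left h2 (by positivity)
  · intro k _ hk
    rw [Polynomial.eval_pow, eval_nodal_of_mem _ (Finset.mem_erase.2 ⟨hk, mem_univ _⟩)]
    simp
  · simp

namespace GaussLobattoRule

variable {L : ℕ} (h : GaussLobattoRule L)

def first : Fin L := ⟨0, by have := h.two_le; omega⟩

def last : Fin L := ⟨L - 1, by have := h.two_le; omega⟩

theorem first_ne_last : h.first ≠ h.last := by
  have := h.two_le
  simp only [first, last, ne_eq, Fin.mk.injEq]; omega

theorem node_mem (ν : Fin L) : h.node ν ∈ Set.Icc (-1 / 2 : ℝ) (1 / 2) := by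
  have hν := ν.isLt
  refine ⟨?_, ?_⟩
  · rw [← h.node_first]
    exact h.node_strictMono.monotone (Fin.mk_le_of_le_val (Nat.zero_le _))
  · rw [← h.node_last]
    exact h.node_strictMono.monotone (Fin.le_def.2 (by simp only []; omega))

/-- The indices of the nodes inside the interval. -/
def interior : Finset (Fin L) := (univ.erase h.first).erase h.last

theorem mem_interior {ν : Fin L} : ν ∈ h.interior ↔ ν ≠ h.last ∧ ν ≠ h.first := by
  simp [interior]

theorem card_interior : #h.interior = L - 2 := by
  rw [interior, Finset.card_erase_of_mem, Finset.card_erase_of_mem (mem_univ _), Finset.card_univ,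
    Fintype.card_fin]
  · omega
  · simp [h.first_ne_last.symm]

/-- Same test, with the factor `1 / 4 - s ^ 2` removing both end points while staying nonnegative on
the interval. -/
theorem weight_nonneg_of_interior {ν : Fin L} (hν : ν ∈ h.interior) : 0 ≤ h.weight ν := by
  have hL := h.two_le
  have hcard := h.card_interior
  have hpos := Finset.card_pos.2 ⟨ν, hν⟩
  have hinj := h.node_strictMono.injective
  have hf : h.node h.first = -1 / 2 := h.node_first
  have hl : h.node h.last = 1 / 2 := h.node_last
  obtain ⟨hνl, hνf⟩ := h.mem_interior.1 hν
  have hne := eval_nodal_ne_zero hinj (Finset.notMem_erase ν h.interior)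
  set q := nodal h.node (h.interior.erase ν) with hq
  have hdeg : q.natDegree = L - 3 := by
    rw [hq, natDegree_nodal, Finset.card_erase_of_mem hν, hcard]; omega
  have hev : ∀ s : ℝ, ((Polynomial.C (1 / 4) - Polynomial.X ^ 2) * q ^ 2).eval s
      = (1 / 4 - s ^ 2) * q.eval s ^ 2 := fun s => by simp
  have hex := h.exact ((Polynomial.C (1 / 4) - Polynomial.X ^ 2) * q ^ 2) (by
    have h1 : ((Polynomial.C (1 / 4) - Polynomial.X ^ 2) * q ^ 2 : Polynomial ℝ).natDegree
        ≤ 2 + 2 * (L - 3) := by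
      refine Polynomial.natDegree_mul_le.trans (add_le_add ?_ ?_)
      · compute_degree
      · rw [Polynomial.natDegree_pow, hdeg]
    omega)
  have h2 : 0 ≤ ∫ s in (-1 / 2 : ℝ)..(1 / 2),
      ((Polynomial.C (1 / 4) - Polynomial.X ^ 2) * q ^ 2).eval s :=
    intervalIntegral.integral_nonneg (by norm_num) fun s hs => by
      rw [hev]
      exact mul_nonneg (by nlinarith [hs.1, hs.2]) (sq_nonneg _)
  rw [← hex, Finset.sum_eq_single ν] at h2
  · rw [hev] at h2
    refine nonneg_of_mul_nonneg_left h2 (mul_pos ?_ (by positivity))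
    obtain ⟨h3, h4⟩ := h.node_mem ν
    have h5 : -1 / 2 < h.node ν := lt_of_le_of_ne h3 fun e => hνf (hinj (by rw [hf, e]))
    have h6 : h.node ν < 1 / 2 := lt_of_le_of_ne h4 fun e => hνl (hinj (by rw [hl, e]))
    nlinarith
  · intro k _ hk
    rw [hev]
    by_cases hkf : k = h.first
    · rw [hkf, hf]; norm_num
    by_cases hkl : k = h.last
    · rw [hkl, hl]; norm_num
    rw [hq, eval_nodal_of_mem _ (Finset.mem_erase.2 ⟨hk, h.mem_interior.2 ⟨hkl, hkf⟩⟩)]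
    simp
  · simp

theorem sum_eq_first_last_interior (f : Fin L → ℝ) :
    ∑ ν, f ν = f h.first + f h.last + ∑ ν ∈ h.interior, f ν := by
  rw [← Finset.add_sum_erase univ f (mem_univ h.first),
    ← Finset.add_sum_erase (univ.erase h.first) f
      (Finset.mem_erase.2 ⟨h.first_ne_last.symm, mem_univ h.last⟩), add_assoc, interior]

/-- A substitute for the symmetry of the weights. `(1 / 2 + s) * q ^ 2` sees only the last node. Its
reflection has the same integral and sees the first node with the same value, besides nonnegative
interior terms. The degree `2 * L - 3` is the largest allowed. -/
theorem weight_first_le_weight_last : h.weight h.first ≤ h.weight h.last := by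
  have hL := h.two_le
  have hinj := h.node_strictMono.injective
  have hf : h.node h.first = -1 / 2 := h.node_first
  have hl : h.node h.last = 1 / 2 := h.node_last
  have hne := eval_nodal_ne_zero hinj (s := h.interior) (k := h.last)
    (fun hm => (h.mem_interior.1 hm).1 rfl)
  rw [hl] at hne
  have hroot : ∀ ν ∈ h.interior, (nodal h.node h.interior).eval (h.node ν) = 0 :=
    fun ν hν => eval_nodal_of_mem _ hν
  have hdeg : (nodal h.node h.interior).natDegree = L - 2 := by
    rw [natDegree_nodal, h.card_interior]
  set q := nodal h.node h.interior
  have hev : ∀ s : ℝ, ((Polynomial.C (1 / 2) + Polynomial.X) * q ^ 2).eval s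
      = (1 / 2 + s) * q.eval s ^ 2 := fun s => by simp
  have hev' : ∀ s : ℝ, ((Polynomial.C (1 / 2) - Polynomial.X) * (q.comp (-Polynomial.X)) ^ 2).eval s
      = (1 / 2 - s) * q.eval (-s) ^ 2 := fun s => by simp
  have hex := h.exact ((Polynomial.C (1 / 2) + Polynomial.X) * q ^ 2) (by
    have h1 : ((Polynomial.C (1 / 2) + Polynomial.X) * q ^ 2 : Polynomial ℝ).natDegree
        ≤ 1 + 2 * (L - 2) := by
      refine Polynomial.natDegree_mul_le.trans (add_le_add ?_ ?_)
      · compute_degree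
      · rw [Polynomial.natDegree_pow, hdeg]
    omega)
  have hex' := h.exact ((Polynomial.C (1 / 2) - Polynomial.X) * (q.comp (-Polynomial.X)) ^ 2) (by
    have h1 : ((Polynomial.C (1 / 2) - Polynomial.X) * (q.comp (-Polynomial.X)) ^ 2 :
        Polynomial ℝ).natDegree ≤ 1 + 2 * (L - 2) := by
      refine Polynomial.natDegree_mul_le.trans (add_le_add ?_ ?_)
      · compute_degree
      · rw [Polynomial.natDegree_pow, Polynomial.natDegree_comp, hdeg, Polynomial.natDegree_neg,
          Polynomial.natDegree_X, mul_one]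
    omega)
  have hrefl : ∫ s in (-1 / 2 : ℝ)..(1 / 2),
        ((Polynomial.C (1 / 2) - Polynomial.X) * (q.comp (-Polynomial.X)) ^ 2).eval s
      = ∫ s in (-1 / 2 : ℝ)..(1 / 2), ((Polynomial.C (1 / 2) + Polynomial.X) * q ^ 2).eval s := by
    have h1 := intervalIntegral.integral_comp_neg (a := (-1 / 2 : ℝ)) (b := 1 / 2)
      (fun s => ((Polynomial.C (1 / 2) + Polynomial.X) * q ^ 2).eval s)
    rw [show -(1 / 2 : ℝ) = -1 / 2 by norm_num, show -(-1 / 2 : ℝ) = 1 / 2 by norm_num] at h1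
    rw [← h1]
    refine intervalIntegral.integral_congr fun s _ => ?_
    simp only [hev, hev']
    ring
  rw [hrefl, ← hex, h.sum_eq_first_last_interior, h.sum_eq_first_last_interior] at hex'
  simp only [hev, hev', hf, hl] at hex'
  rw [Finset.sum_eq_zero (s := h.interior) (f := fun ν => h.weight ν *
    ((1 / 2 + h.node ν) * Polynomial.eval (h.node ν) q ^ 2))
    (fun ν hν => by rw [hroot ν hν]; ring)] at hex'
  have hnn : 0 ≤ ∑ ν ∈ h.interior, h.weight ν *
      ((1 / 2 - h.node ν) * Polynomial.eval (-h.node ν) q ^ 2) :=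
    Finset.sum_nonneg fun ν hν => mul_nonneg (h.weight_nonneg_of_interior hν)
      (mul_nonneg (by linarith [(h.node_mem ν).2]) (sq_nonneg _))
  have hpos : 0 < q.eval (1 / 2) ^ 2 := by positivity
  rw [show -(-1 / 2 : ℝ) = 1 / 2 by norm_num] at hex'
  refine le_of_mul_le_mul_right ?_ hpos
  linarith

end GaussLobattoRule

/-! ### Exact quadrature of cell averages -/

theorem exists_polynomial_of_mvPolynomial (P : MvPolynomial (Fin 2) ℝ) {K : ℕ}
    (hP : P.totalDegree ≤ K) (a b c d : ℝ) :
    ∃ q : Polynomial ℝ, q.natDegree ≤ K ∧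
      ∀ s, q.eval s = MvPolynomial.eval ![a + s * b, c + s * d] P := by
  refine ⟨MvPolynomial.aeval ![Polynomial.C a + Polynomial.X * Polynomial.C b,
    Polynomial.C c + Polynomial.X * Polynomial.C d] P, ?_, fun s => ?_⟩
  · rw [← mul_one K]
    refine MvPolynomial.aeval_natDegree_le P hP _ fun k => ?_
    fin_cases k <;> simp <;> compute_degree
  · rw [← Polynomial.coe_aeval_eq_eval, ← MvPolynomial.coe_aeval_eq_eval, RingHom.coe_coe,
      MvPolynomial.comp_aeval_apply]
    congr 2
    funext k
    fin_cases k <;> simp <;> ring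

/-- Restricted to a line parallel to an axis, each component is a univariate polynomial of degree at
most `K`, so Fubini-style iteration of two exact rules applies. It serves for both orders of Gauss
and Gauss–Lobatto. -/
theorem cellAverage_eq_sum {ι κ : Type*} [Fintype ι] [Fintype κ] {K : ℕ}
    (x u : ι → ℝ) (y w : κ → ℝ)
    (hx : ∀ q : Polynomial ℝ, q.natDegree ≤ K →
      ∑ a, u a * q.eval (x a) = ∫ s in (-1 / 2 : ℝ)..(1 / 2), q.eval s)
    (hy : ∀ q : Polynomial ℝ, q.natDegree ≤ K →
      ∑ b, w b * q.eval (y b) = ∫ s in (-1 / 2 : ℝ)..(1 / 2), q.eval s)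
    (M : Mesh) {P : PolyVec} (hP : HasDegreeLE P K) (i j : ℤ) :
    cellAverage M P i j =
      ∑ a, ∑ b, (u a * w b) • polyEval P (M.xAt i (x a)) (M.yAt j (y b)) := by
  funext k
  have hdx := M.dx_pos
  have hdy := M.dy_pos
  have hX : ∀ f : ℝ → ℝ, ∫ t in (M.xHalf (i - 1))..(M.xHalf i), f t
      = M.dx * ∫ s in (-1 / 2 : ℝ)..(1 / 2), f (M.xAt i s) := fun f => by
    have h1 := intervalIntegral.smul_integral_comp_add_mul (a := -1 / 2) (b := 1 / 2) f M.dx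
      (M.x0 + i * M.dx)
    rw [smul_eq_mul] at h1
    rw [show M.xHalf (i - 1) = M.x0 + i * M.dx + M.dx * (-1 / 2) by
        simp only [Mesh.xHalf]; push_cast; ring,
      show M.xHalf i = M.x0 + i * M.dx + M.dx * (1 / 2) by simp only [Mesh.xHalf]; ring, ← h1]
    simp only [Mesh.xAt, mul_comm]
  have hY : ∀ f : ℝ → ℝ, ∫ t in (M.yHalf (j - 1))..(M.yHalf j), f t
      = M.dy * ∫ s in (-1 / 2 : ℝ)..(1 / 2), f (M.yAt j s) := fun f => by
    have h1 := intervalIntegral.smul_integral_comp_add_mul (a := -1 / 2) (b := 1 / 2) f M.dy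
      (M.y0 + j * M.dy)
    rw [smul_eq_mul] at h1
    rw [show M.yHalf (j - 1) = M.y0 + j * M.dy + M.dy * (-1 / 2) by
        simp only [Mesh.yHalf]; push_cast; ring,
      show M.yHalf j = M.y0 + j * M.dy + M.dy * (1 / 2) by simp only [Mesh.yHalf]; ring, ← h1]
    simp only [Mesh.yAt, mul_comm]
  have hin : ∀ t, ∫ s in (-1 / 2 : ℝ)..(1 / 2), polyEval P t (M.yAt j s) k
      = ∑ b, w b * polyEval P t (M.yAt j (y b)) k := fun t => by
    obtain ⟨q, hq, he⟩ := exists_polynomial_of_mvPolynomial (P k) (hP k) t 0 (M.y0 + j * M.dy) M.dy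
    simp only [mul_zero, add_zero] at he
    have h1 := hy q hq
    simp only [he] at h1
    exact h1.symm
  have hout : ∀ b, ∫ s in (-1 / 2 : ℝ)..(1 / 2), polyEval P (M.xAt i s) (M.yAt j (y b)) k
      = ∑ a, u a * polyEval P (M.xAt i (x a)) (M.yAt j (y b)) k := fun b => by
    obtain ⟨q, hq, he⟩ := exists_polynomial_of_mvPolynomial (P k) (hP k) (M.x0 + i * M.dx) M.dx
      (M.yAt j (y b)) 0
    simp only [mul_zero, add_zero] at he
    have h1 := hx q hq
    simp only [he] at h1
    exact h1.symm
  have hcont : ∀ b, Continuous fun s => polyEval P (M.xAt i s) (M.yAt j (y b)) k := fun b => by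
    obtain ⟨q, -, he⟩ := exists_polynomial_of_mvPolynomial (P k) (hP k) (M.x0 + i * M.dx) M.dx
      (M.yAt j (y b)) 0
    simp only [mul_zero, add_zero] at he
    have h1 := q.continuous
    simp only [he] at h1
    exact h1
  have h1 : cellAverage M P i j k = ∑ b, w b *
      ∑ a, u a * polyEval P (M.xAt i (x a)) (M.yAt j (y b)) k := by
    simp only [cellAverage, hX, hY, hin]
    rw [intervalIntegral.integral_const_mul, intervalIntegral.integral_finsetSum
      (f := fun b s => w b * polyEval P (M.xAt i s) (M.yAt j (y b)) k)
      (fun b _ => ((hcont b).intervalIntegrable _ _).const_mul _)]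
    simp only [intervalIntegral.integral_const_mul, hout]
    field_simp
  rw [h1]
  simp only [Finset.sum_apply, Pi.smul_apply, smul_eq_mul, Finset.mul_sum]
  rw [Finset.sum_comm]
  exact Finset.sum_congr rfl fun a _ => Finset.sum_congr rfl fun b _ => by ring

/-! ### From the splitting property to the scheme -/

/-- A linear functional `φ` on states together with constants `c`, `d` for which `φ + c` is
positive on admissible states and satisfies the splitting property with source strength `d`. -/
structure SplittingFunctional (p : ℝ → ℝ → ℝ) (φ : State →ₗ[ℝ] ℝ) (c d : ℝ) : Prop where
  pos : ∀ {U : State}, U ∈ admissibleSet → 0 < φ U + c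
  splitting : ∀ (ℓ : Fin 3) {U V : State}, U ∈ admissibleSet → V ∈ admissibleSet →
    ∀ {α : ℝ}, alpha p ℓ U V < α →
      0 < α * (φ U + c) + α * (φ V + c) - φ (flux p ℓ U) + φ (flux p ℓ V)
        + d * (magnetic U ℓ - magnetic V ℓ)

theorem map_lfFlux (p : ℝ → ℝ → ℝ) (ℓ : Fin 3) (α : ℝ) (Um Up : State) (φ : State →ₗ[ℝ] ℝ) :
    φ (lfFlux p ℓ α Um Up)
      = 1 / 2 * (φ (flux p ℓ Um) + φ (flux p ℓ Up) - α * (φ Up - φ Um)) := by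
  simp [lfFlux]

/-- Positivity of one directional contribution to the updated average. -/
theorem SplittingFunctional.directional_pos {p : ℝ → ℝ → ℝ} {φ : State →ₗ[ℝ] ℝ} {c d : ℝ}
    (hφ : SplittingFunctional p φ c d) {L : ℕ} (h : GaussLobattoRule L) (ℓ : Fin 3)
    {u : Fin L → State} (hu : ∀ ν, u ν ∈ admissibleSet) {mL pR : State} (hmL : mL ∈ admissibleSet)
    (hpR : pR ∈ admissibleSet) {α t κ lam : ℝ} (ht : 0 < t) (hκ : 0 ≤ κ)
    (hκlam : κ * lam = α * t) (hlam : lam ≤ h.weight h.first)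
    (hαm : alpha p ℓ (u h.last) mL < α) (hαp : alpha p ℓ pR (u h.first) < α) :
    0 < κ * ∑ ν, h.weight ν * φ (u ν) + κ * c
      - t * (φ (lfFlux p ℓ α (u h.last) pR) - φ (lfFlux p ℓ α mL (u h.first)))
      + d * (t * (1 / 2 * (magnetic (u h.last) ℓ + magnetic pR ℓ)
        - 1 / 2 * (magnetic mL ℓ + magnetic (u h.first) ℓ))) := by
  -- With `α * t` copies of both end values taken from the average, the flux terms become exactly
  -- half of `hm` plus half of `hp`.
  have hm := mul_pos ht (hφ.splitting ℓ (hu h.last) hmL hαm)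
  have hp := mul_pos ht (hφ.splitting ℓ hpR (hu h.first) hαp)
  have hsum : κ * ∑ ν, h.weight ν * φ (u ν) + κ * c
      = κ * ∑ ν, h.weight ν * (φ (u ν) + c) := by
    simp only [mul_add, Finset.sum_add_distrib, ← Finset.sum_mul, h.sum_weight, one_mul]
  have hlow : lam * (φ (u h.first) + c) + lam * (φ (u h.last) + c)
      ≤ ∑ ν, h.weight ν * (φ (u ν) + c) := by
    rw [h.sum_eq_first_last_interior]
    have h1 := mul_le_mul_of_nonneg_right hlam (hφ.pos (hu h.first)).le
    have h2 := mul_le_mul_of_nonneg_right (hlam.trans h.weight_first_le_weight_last)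
      (hφ.pos (hu h.last)).le
    have h3 : 0 ≤ ∑ ν ∈ h.interior, h.weight ν * (φ (u ν) + c) :=
      Finset.sum_nonneg fun ν hν =>
        mul_nonneg (h.weight_nonneg_of_interior hν) (hφ.pos (hu ν)).le
    linarith
  have hlow' := mul_le_mul_of_nonneg_left hlow hκ
  rw [show κ * (lam * (φ (u h.first) + c) + lam * (φ (u h.last) + c))
    = α * t * (φ (u h.first) + c) + α * t * (φ (u h.last) + c) by rw [← hκlam]; ring] at hlow'
  rw [hsum, map_lfFlux, map_lfFlux]
  linarith

theorem GaussRule.sum_mul_pos {Q : ℕ} (g : GaussRule Q) {f : Fin Q → ℝ} (hf : ∀ μ, 0 < f μ) :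
    0 < ∑ μ, g.weight μ * f μ := by
  have hne : ∃ μ, 0 < g.weight μ := by
    by_contra! hle
    have := Finset.sum_nonpos fun μ (_ : μ ∈ univ) => hle μ
    rw [g.sum_weight] at this
    linarith
  obtain ⟨μ, hμ⟩ := hne
  exact Finset.sum_pos' (fun k _ => mul_nonneg (g.weight_nonneg k) (hf k).le)
    ⟨μ, mem_univ μ, mul_pos hμ (hf μ)⟩

theorem Mesh.xAt_half (M : Mesh) (i : ℤ) : M.xAt i (1 / 2) = M.xHalf i := by
  simp only [Mesh.xAt, Mesh.xHalf]; ring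

theorem Mesh.xAt_neg_half (M : Mesh) (i : ℤ) : M.xAt i (-1 / 2) = M.xHalf (i - 1) := by
  simp only [Mesh.xAt, Mesh.xHalf]; push_cast; ring

theorem Mesh.yAt_half (M : Mesh) (j : ℤ) : M.yAt j (1 / 2) = M.yHalf j := by
  simp only [Mesh.yAt, Mesh.yHalf]; ring

theorem Mesh.yAt_neg_half (M : Mesh) (j : ℤ) : M.yAt j (-1 / 2) = M.yHalf (j - 1) := by
  simp only [Mesh.yAt, Mesh.yHalf]; push_cast; ring

theorem SplittingFunctional.nextAverage_pos {p : ℝ → ℝ → ℝ} {φ : State →ₗ[ℝ] ℝ} {c d : ℝ}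
    (hφ : SplittingFunctional p φ c d) (M : Mesh)
    {K Q L : ℕ} (hQ : K + 1 ≤ 2 * Q) (hL : K + 3 ≤ 2 * L)
    (g : GaussRule Q) (h : GaussLobattoRule L)
    {U : ℤ → ℤ → PolyVec} (hdeg : ∀ i j, HasDegreeLE (U i j) K)
    (hadm : AdmissibleAtNodes M g h U)
    {α₁ α₂ : ℝ} (hα : ViscosityCondition p M g U α₁ α₂) {dt : ℝ} (hα₁ : 0 < α₁) (hα₂ : 0 < α₂)
    (hdt : 0 < dt)
    (hCFL_pos : 0 < α₁ * dt / M.dx + α₂ * dt / M.dy)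
    (hCFL_le : α₁ * dt / M.dx + α₂ * dt / M.dy ≤ h.firstWeight) (i j : ℤ) :
    0 < φ (nextAverage p M g U α₁ α₂ dt i j) + c + d * (dt * discreteDiv M g U i j) := by
  have hdx := M.dx_pos
  have hdy := M.dy_pos
  have hG : ∀ q : Polynomial ℝ, q.natDegree ≤ K →
      ∑ μ, g.weight μ * q.eval (g.node μ) = ∫ s in (-1 / 2 : ℝ)..(1 / 2), q.eval s :=
    fun q hq => g.exact q (by omega)
  have hGL : ∀ q : Polynomial ℝ, q.natDegree ≤ K →
      ∑ ν, h.weight ν * q.eval (h.node ν) = ∫ s in (-1 / 2 : ℝ)..(1 / 2), q.eval s :=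
    fun q hq => h.exact q (by omega)
  have hf : h.node h.first = -1 / 2 := h.node_first
  have hl : h.node h.last = 1 / 2 := h.node_last
  have hxm : ∀ i j μ, xMinus M g U i j μ
      = polyEval (U i j) (M.xAt i (h.node h.last)) (M.yAt j (g.node μ)) := fun i j μ => by
    rw [hl, M.xAt_half]; rfl
  have hxp : ∀ i j μ, xPlus M g U (i - 1) j μ
      = polyEval (U i j) (M.xAt i (h.node h.first)) (M.yAt j (g.node μ)) := fun i j μ => by
    rw [hf, M.xAt_neg_half, xPlus, sub_add_cancel]
  have hym : ∀ i j μ, yMinus M g U i j μ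
      = polyEval (U i j) (M.xAt i (g.node μ)) (M.yAt j (h.node h.last)) := fun i j μ => by
    rw [hl, M.yAt_half]; rfl
  have hyp : ∀ i j μ, yPlus M g U i (j - 1) μ
      = polyEval (U i j) (M.xAt i (g.node μ)) (M.yAt j (h.node h.first)) := fun i j μ => by
    rw [hf, M.yAt_neg_half, yPlus, sub_add_cancel]
  have hxp_adm : xPlus M g U i j ∈ Set.pi Set.univ fun _ => admissibleSet := fun μ _ => by
    have h1 := hxp (i + 1) j μ
    rw [add_sub_cancel_right] at h1
    rw [h1]; exact (hadm _ _ _ _).1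
  have hyp_adm : yPlus M g U i j ∈ Set.pi Set.univ fun _ => admissibleSet := fun μ _ => by
    have h1 := hyp i (j + 1) μ
    rw [add_sub_cancel_right] at h1
    rw [h1]; exact (hadm _ _ _ _).2
  set lam := α₁ * dt / M.dx + α₂ * dt / M.dy with hlam
  -- The average is shared between the directions in proportion to their CFL numbers, so both need
  -- the same end weight `lam`.
  set κ₁ := α₁ * dt / M.dx / lam with hκ₁
  set κ₂ := α₂ * dt / M.dy / lam with hκ₂
  have hκ : κ₁ + κ₂ = 1 := by rw [hκ₁, hκ₂, ← add_div, ← hlam, div_self hCFL_pos.ne']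
  have hκ₁' : κ₁ * lam = α₁ * (dt / M.dx) := by
    rw [hκ₁, div_mul_cancel₀ _ hCFL_pos.ne']; ring
  have hκ₂' : κ₂ * lam = α₂ * (dt / M.dy) := by
    rw [hκ₂, div_mul_cancel₀ _ hCFL_pos.ne']; ring
  have hx : ∀ μ, _ := fun μ => hφ.directional_pos h 0 (κ := κ₁) (t := dt / M.dx)
    (fun ν => (hadm i j μ ν).1) (mL := xMinus M g U (i - 1) j μ) (pR := xPlus M g U i j μ)
    (by rw [hxm]; exact (hadm _ _ _ _).1) (hxp_adm μ trivial) (by positivity)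
    (by positivity) hκ₁' hCFL_le (by rw [← hxm]; exact (hα i j μ).1)
    (by rw [← hxp]; exact (hα i j μ).2.1)
  have hy : ∀ μ, _ := fun μ => hφ.directional_pos h 1 (κ := κ₂) (t := dt / M.dy)
    (fun ν => (hadm i j μ ν).2) (mL := yMinus M g U i (j - 1) μ) (pR := yPlus M g U i j μ)
    (by rw [hym]; exact (hadm _ _ _ _).2) (hyp_adm μ trivial) (by positivity)
    (by positivity) hκ₂' hCFL_le (by rw [← hym]; exact (hα i j μ).2.2.1)
    (by rw [← hyp]; exact (hα i j μ).2.2.2)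
  simp only [← hxm, ← hxp] at hx
  simp only [← hym, ← hyp] at hy
  have hX := g.sum_mul_pos hx
  have hY := g.sum_mul_pos hy
  have hav₁ : φ (cellAverage M (U i j) i j) = ∑ μ, g.weight μ * ∑ ν, h.weight ν *
      φ (polyEval (U i j) (M.xAt i (h.node ν)) (M.yAt j (g.node μ))) := by
    rw [cellAverage_eq_sum h.node h.weight g.node g.weight hGL hG M (hdeg i j), Finset.sum_comm]
    simp only [map_sum, map_smul, smul_eq_mul, Finset.mul_sum]
    exact Finset.sum_congr rfl fun a _ => Finset.sum_congr rfl fun b _ => by ring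
  have hav₂ : φ (cellAverage M (U i j) i j) = ∑ μ, g.weight μ * ∑ ν, h.weight ν *
      φ (polyEval (U i j) (M.xAt i (g.node μ)) (M.yAt j (h.node ν))) := by
    rw [cellAverage_eq_sum g.node g.weight h.node h.weight hG hGL M (hdeg i j)]
    simp only [map_sum, map_smul, smul_eq_mul, Finset.mul_sum]
    exact Finset.sum_congr rfl fun a _ => Finset.sum_congr rfl fun b _ => by ring
  have hsplit : ∀ (κ t : ℝ) (A F D : Fin Q → ℝ),
      ∑ μ, g.weight μ * (κ * A μ + κ * c - t * F μ + d * (t * D μ))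
        = κ * ∑ μ, g.weight μ * A μ + κ * c - t * ∑ μ, g.weight μ * F μ
          + d * (t * ∑ μ, g.weight μ * D μ) := fun κ t A F D => by
    have hc : κ * c = ∑ μ, g.weight μ * (κ * c) := by
      rw [← Finset.sum_mul, g.sum_weight, one_mul]
    rw [hc]
    simp only [Finset.mul_sum, ← Finset.sum_add_distrib, ← Finset.sum_sub_distrib]
    refine Finset.sum_congr rfl fun μ _ => ?_
    rw [← Finset.sum_mul, g.sum_weight]
    ring
  rw [hsplit, ← hav₁] at hX
  rw [hsplit, ← hav₂] at hY
  have hnext : φ (nextAverage p M g U α₁ α₂ dt i j) = φ (cellAverage M (U i j) i j)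
      - dt / M.dx * ∑ μ, g.weight μ * (φ (lfFlux p 0 α₁ (xMinus M g U i j μ) (xPlus M g U i j μ))
        - φ (lfFlux p 0 α₁ (xMinus M g U (i - 1) j μ) (xPlus M g U (i - 1) j μ)))
      - dt / M.dy * ∑ μ, g.weight μ * (φ (lfFlux p 1 α₂ (yMinus M g U i j μ) (yPlus M g U i j μ))
        - φ (lfFlux p 1 α₂ (yMinus M g U i (j - 1) μ) (yPlus M g U i (j - 1) μ))) := by
    simp only [nextAverage, map_sub, map_smul, map_sum, smul_eq_mul]
  have hdiv : dt * discreteDiv M g U i j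
      = dt / M.dx * (∑ μ, g.weight μ * (meanB1 M g U i j μ - meanB1 M g U (i - 1) j μ))
        + dt / M.dy * (∑ μ, g.weight μ * (meanB2 M g U i j μ - meanB2 M g U i (j - 1) μ)) := by
    rw [discreteDiv]; ring
  rw [hnext, hdiv]
  simp only [meanB1, meanB2]
  have e : φ (cellAverage M (U i j) i j) + c
      = (κ₁ * φ (cellAverage M (U i j) i j) + κ₁ * c)
        + (κ₂ * φ (cellAverage M (U i j) i j) + κ₂ * c) := by
    linear_combination (-(φ (cellAverage M (U i j) i j) + c)) * hκ
  linarith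

/-! ### The two functionals and the conclusion -/

theorem splittingFunctional_density (p : ℝ → ℝ → ℝ) :
    SplittingFunctional p (LinearMap.proj 0) 0 0 where
  pos hU := by simpa [density] using hU.1
  splitting ℓ U V hU hV α hα := by
    have := density_splitting_pos p ℓ hU hV hα
    simp only [LinearMap.proj_apply, add_zero, zero_mul]
    exact this

theorem splittingFunctional_entropyForm (p : ℝ → ℝ → ℝ) (v B : Fin 3 → ℝ) :
    SplittingFunctional p (entropyForm v B) (normSq B / 2) (v ⬝ᵥ B) where
  pos {U} hU := by
    rw [entropyForm_eq hU.1.ne']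
    have h1 := mul_pos hU.1 (specificEnergy_pos hU)
    have h2 := mul_nonneg hU.1.le (normSq_nonneg (velocity U - v))
    have h3 := normSq_nonneg (magnetic U - B)
    linarith
  splitting ℓ _ _ hU hV _ hα := entropyForm_splitting_pos p ℓ hU hV hα v B

end IdealMHD

end

open IdealMHD

theorem theorem4p10
    (p : ℝ → ℝ → ℝ) (hp : IsEOS p)
    (M : Mesh)
    (K Q L : ℕ) (hQ : K + 1 ≤ 2 * Q) (hL : K + 3 ≤ 2 * L)
    (g : GaussRule Q) (h : GaussLobattoRule L)
    (U : ℤ → ℤ → PolyVec) (hdeg : ∀ i j, HasDegreeLE (U i j) K)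
    (hadm : AdmissibleAtNodes M g h U)
    (α₁ α₂ : ℝ) (hα : ViscosityCondition p M g U α₁ α₂)
    (dt : ℝ)
    (hCFL_pos : 0 < α₁ * dt / M.dx + α₂ * dt / M.dy)
    (hCFL_le : α₁ * dt / M.dx + α₂ * dt / M.dy ≤ h.firstWeight)
    (i j : ℤ) :
    0 < density (nextAverage p M g U α₁ α₂ dt i j) ∧
    internalEnergy (nextAverage p M g U α₁ α₂ dt i j) >
      -dt * (velocity (nextAverage p M g U α₁ α₂ dt i j) ⬝ᵥ
        magnetic (nextAverage p M g U α₁ α₂ dt i j)) * discreteDiv M g U i j ∧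
    (internalEnergy (nextAverage p M g U α₁ α₂ dt i j) ≤ 0 →
      |internalEnergy (nextAverage p M g U α₁ α₂ dt i j)| <
        dt * (velocity (nextAverage p M g U α₁ α₂ dt i j) ⬝ᵥ
          magnetic (nextAverage p M g U α₁ α₂ dt i j)) * discreteDiv M g U i j) := by
  have μ₀ : Fin Q := ⟨0, by omega⟩
  have hα₁ : 0 < α₁ := (alpha_nonneg _ _ _ _).trans_lt (hα i j μ₀).1
  have hα₂ : 0 < α₂ := (alpha_nonneg _ _ _ _).trans_lt (hα i j μ₀).2.2.1
  have hdx := M.dx_pos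
  have hdy := M.dy_pos
  -- Both viscosities exceed a nonnegative `alpha`, so positivity of the CFL sum fixes the sign of
  -- `dt`.
  have hdt : 0 < dt := by
    have h1 : 0 < dt * (α₁ / M.dx + α₂ / M.dy) := by
      convert hCFL_pos using 1; ring
    exact pos_of_mul_pos_left h1 (by positivity)
  have hρ : 0 < density (nextAverage p M g U α₁ α₂ dt i j) := by
    have h1 := (splittingFunctional_density p).nextAverage_pos M hQ hL g h hdeg hadm hα hα₁ hα₂ hdt
      hCFL_pos hCFL_le i j
    rw [add_zero, zero_mul, add_zero] at h1
    exact h1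
  set N := nextAverage p M g U α₁ α₂ dt i j with hN
  -- The bound holds for all fixed `v`, `B`, so they may be taken from `N` itself; both squared
  -- deviations then vanish and only the internal energy remains.
  have hE := (splittingFunctional_entropyForm p (velocity N) (magnetic N)).nextAverage_pos M hQ hL g
    h hdeg hadm hα hα₁ hα₂ hdt hCFL_pos hCFL_le i j
  rw [← hN, entropyForm_eq hρ.ne', sub_self, sub_self] at hE
  have hzero : normSq (0 : Fin 3 → ℝ) = 0 := by simp [normSq]
  have hspec : density N * specificEnergy N = internalEnergy N :=
    mul_div_cancel₀ _ hρ.ne'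
  rw [hzero, hspec] at hE
  have hmain : internalEnergy N > -dt * (velocity N ⬝ᵥ magnetic N) * discreteDiv M g U i j := by
    linarith
  refine ⟨hρ, hmain, fun hle => ?_⟩
  rw [abs_of_nonpos hle]
  linarith
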